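/- Let $Q$ be a finite-dimensional (Hausdorff, boundaryless) smooth manifold. A \emph{smooth discretization} of $TQ$ is a triple $(\psi,\alpha^+,\alpha^-)$, where $\psi\colon U\to Q$ is a $C^\infty$ map defined on an open set $U\subset\mathbb{R}^2\times TQ$ with $\{0\}\times\{0\}\times TQ\subset U$, and, for some $a_0>0$, $\alpha^+,\alpha^-\colon(-a_0,a_0)\to\mathbb{R}$ are $C^\infty$ functions such that (1) $h\,\alpha^+(h)\ge 0$, $h\,\alpha^-(h)\le 0$ and $\alpha^+(h)-\alpha^-(h)=h$ for all $h\in(-a_0,a_0)$; (2) $\psi(h,0,v_q)=q$ and $\frac{\partial\psi}{\partial t}(h,t,v_q)\big|_{t=0}=v_q$ for all $h$ and all $v_q\in T_qQ$ with $(h,0,v_q)\in U$. Its boundary maps are $\partial^+_h(v)=\psi(h,\alpha^+(h),v)$ and $\partial^-_h(v)=\psi(h,\alpha^-(h),v)$, defined for those $h\in(-a_0,a_0)$ and $v\in TQ$ with $(h,\alpha^+(h),v)\in U$, respectively $(h,\alpha^-(h),v)\in U$; and $\partial^\pm_h(v)=(\partial^+_h(v),\partial^-_h(v))$ where both are defined.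 A \emph{discrete tangent bundle} of a manifold $M$ is a triple $(\mathcal{V},\partial^+,\partial^-)$, where $\mathcal{V}$ is a manifold with $\dim\mathcal{V}=2\dim M$ and $\partial^+,\partial^-\colon\mathcal{V}\to M$ are smooth submersions such that $\ker(T\partial^+)\cap\ker(T\partial^-)=\{0\}$ and, for every $q\in M$, the set $(\partial^+)^{-1}(q)\cap(\partial^-)^{-1}(q)$ consists of exactly one point. \textbf{Theorem.} Let $(\psi,\alpha^+,\alpha^-)$ be a smooth discretization of $TQ$ and let $Q_0\subset Q$ be a relatively compact open subset (that is, $\overline{Q_0}$ is compact). Then there are $a>0$, with $a\le a_0$, and, for each $h\in(0,a)$, an open subset $\mathcal{V}_h\subset TQ$ on which $\partial^+_h$ and $\partial^-_h$ are both defined and take values in $Q_0$, such that for each $h\in(0,a)$: (i) the triple $(\mathcal{V}_h,\partial^+_h,\partial^-_h)$ is a discrete tangent bundle of $Q_0$; (ii) $\partial^\pm_h$ is a diffeomorphism from $\mathcal{V}_h$ onto an open neighbourhood $\mathcal{W}_h$ of the diagonal $\Delta_{Q_0}$ in $Q_0\times Q_0$. Moreover, for every $q\in Q_0$ and $v_q\in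 T_qQ_0$ there is $a'\in(0,a]$ such that $v_q\in\mathcal{V}_h$ for all $h\in(0,a')$. -/

import Mathlib

open Set
open scoped Manifold ContDiff

/-- A smooth discretization of `TQ`, where `Q` is a smooth manifold modelled on `E`. The map `ψ` is
relevant only on the open set `dom`, and `αp`, `αm` (the boundary times, written
`α⁺`, `α⁻` on paper) only on `(-a, a)`. -/
structure SmoothDiscretization (E : Type*) [NormedAddCommGroup E] [NormedSpace ℝ E]
    (Q : Type*) [TopologicalSpace Q] [ChartedSpace E Q] [IsManifold 𝓘(ℝ, E) ∞ Q] where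
  /-- the domain of `ψ` -/
  dom : Set (ℝ × ℝ × TangentBundle 𝓘(ℝ, E) Q)
  isOpen_dom : IsOpen dom
  /-- the family of curves `t ↦ ψ (h, t, v)` -/
  ψ : ℝ × ℝ × TangentBundle 𝓘(ℝ, E) Q → Q
  /-- the range of the parameter `h` for the boundary times -/
  a : ℝ
  a_pos : 0 < a
  /-- the upper boundary time -/
  αp : ℝ → ℝ
  /-- the lower boundary time -/
  αm : ℝ → ℝ
  zero_mem_dom : ∀ v : TangentBundle 𝓘(ℝ, E) Q, ((0 : ℝ), (0 : ℝ), v) ∈ dom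
  smooth_ψ : ContMDiffOn (𝓘(ℝ, ℝ).prod (𝓘(ℝ, ℝ).prod (𝓘(ℝ, E).tangent))) 𝓘(ℝ, E) ∞ ψ dom
  αp_sign : ∀ h ∈ Ioo (-a) a, 0 ≤ h * αp h
  αm_sign : ∀ h ∈ Ioo (-a) a, h * αm h ≤ 0
  smooth_αp : ContDiffOn ℝ ∞ αp (Ioo (-a) a)
  smooth_αm : ContDiffOn ℝ ∞ αm (Ioo (-a) a)
  αp_sub_αm : ∀ h ∈ Ioo (-a) a, αp h - αm h = h
  ψ_zero : ∀ (h : ℝ) (v : TangentBundle 𝓘(ℝ, E) Q), (h, (0 : ℝ), v) ∈ dom →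
    ψ (h, 0, v) = v.proj
  /-- The velocity at `t = 0` of `t ↦ ψ (h, t, v)`, a tangent vector at `ψ (h, 0, v)`, is `v`;
  the equation is one between points of the tangent bundle. -/
  velocity_zero : ∀ (h : ℝ) (v : TangentBundle 𝓘(ℝ, E) Q), (h, (0 : ℝ), v) ∈ dom →
    (⟨ψ (h, 0, v), mfderiv 𝓘(ℝ, ℝ) 𝓘(ℝ, E) (fun t : ℝ => ψ (h, t, v)) 0 (1 : ℝ)⟩ :
      TangentBundle 𝓘(ℝ, E) Q) = v

namespace SmoothDiscretization

variable {E : Type*} [NormedAddCommGroup E] [NormedSpace ℝ E]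
  {Q : Type*} [TopologicalSpace Q] [ChartedSpace E Q] [IsManifold 𝓘(ℝ, E) ∞ Q]

/-- The domain `U⁺ ⊆ (-a, a) × TQ` of the boundary map `∂⁺`. -/
def domPlus (D : SmoothDiscretization E Q) : Set (ℝ × TangentBundle 𝓘(ℝ, E) Q) :=
  {p | p.1 ∈ Ioo (-D.a) D.a ∧ (p.1, D.αp p.1, p.2) ∈ D.dom}

/-- The domain `U⁻ ⊆ (-a, a) × TQ` of the boundary map `∂⁻`. -/
def domMinus (D : SmoothDiscretization E Q) : Set (ℝ × TangentBundle 𝓘(ℝ, E) Q) :=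
  {p | p.1 ∈ Ioo (-D.a) D.a ∧ (p.1, D.αm p.1, p.2) ∈ D.dom}

/-- The boundary map `∂⁺_h(v) = ψ(h, α⁺(h), v)`. -/
def bdPlus (D : SmoothDiscretization E Q) (h : ℝ) (v : TangentBundle 𝓘(ℝ, E) Q) : Q :=
  D.ψ (h, D.αp h, v)

/-- The boundary map `∂⁻_h(v) = ψ(h, α⁻(h), v)`. -/
def bdMinus (D : SmoothDiscretization E Q) (h : ℝ) (v : TangentBundle 𝓘(ℝ, E) Q) : Q :=
  D.ψ (h, D.αm h, v)

end SmoothDiscretization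

/-- `(V, dp, dm)` is a discrete tangent bundle of `Q`: `V` is a (Hausdorff) manifold of
dimension `2 dim Q`, the smooth maps `dp`, `dm` (written `∂⁺`, `∂⁻` on paper) from `V` to `Q` are
submersions whose tangent maps have kernels that intersect trivially, and for every `q` the fibres
of `dp` and `dm` over `q` have exactly one common point. -/
structure IsDiscreteTangentBundle
    {F : Type*} [NormedAddCommGroup F] [NormedSpace ℝ F] [FiniteDimensional ℝ F]
    {G : Type*} [TopologicalSpace G] (J : ModelWithCorners ℝ F G) [J.Boundaryless]
    {E : Type*} [NormedAddCommGroup E] [NormedSpace ℝ E] [FiniteDimensional ℝ E]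
    {H : Type*} [TopologicalSpace H] (I : ModelWithCorners ℝ E H) [I.Boundaryless]
    {V : Type*} [TopologicalSpace V] [ChartedSpace G V] [IsManifold J ∞ V]
    {Q : Type*} [TopologicalSpace Q] [ChartedSpace H Q] [IsManifold I ∞ Q]
    (dp dm : V → Q) : Prop where
  t2Space_total : T2Space V
  finrank_eq : Module.finrank ℝ F = 2 * Module.finrank ℝ E
  smooth_plus : ContMDiff J I ∞ dp
  smooth_minus : ContMDiff J I ∞ dm
  submersion_plus : ∀ v : V, Function.Surjective (mfderiv J I dp v)
  submersion_minus : ∀ v : V, Function.Surjective (mfderiv J I dm v)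
  ker_inf_ker : ∀ v : V, ∀ w : TangentSpace J v,
    mfderiv J I dp v w = 0 → mfderiv J I dm v w = 0 → w = 0
  existsUnique_zero : ∀ q : Q, ∃! v : V, dp v = q ∧ dm v = q

open Filter Topology Metric

/-! In a chart, `ψ(h, t, (x, w)) = x + t w + g(h, t, x, w)`, where both `g` and `∂g/∂t` vanish at `t
= 0`. As this holds for all `(x, w)`, the derivative of `∂g/∂t` in `(x, w)` vanishes there too, so
`g` is `δ|t|`-small and `δ|t|`-Lipschitz in `(x, w)` for small `h` and `t`, with bounded `w`.

Both boundary values tend to the base point as `h → 0`, so `∂^±_h` degenerates. Replacing the pair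
`(x⁺, x⁻)` by `(x⁻, (x⁺ - x⁻) / h)` removes the degeneracy: since `α⁺ ≥ 0 ≥ α⁻` and `α⁺ - α⁻ = h`,
the errors add up to at most `δ h`, and the rescaled map is `C¹`-close to the identity
(`exists_chartPair_approx`). Near given vectors and for small `h > 0` this yields injectivity
(`eventually_injective`), a smooth local inverse (`eventually_hasSmoothRightInverseAt`) and
preimages of diagonal points near the zero section (`eventually_exists_diagonal`).

Compactness makes these properties uniform on each member of an increasing sequence of compact sets
`K n` whose interiors cover the vectors over the closure of `Q₀`. The domain `V h` collects all
stages `n` that are good for `h`. Joint injectivity and invertible derivatives of `∂^±_h` then give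
the diffeomorphism and all the axioms of a discrete tangent bundle. -/

/-! ### Estimates in a vector space -/

theorem exists_remainder_lipschitz {E : Type*} [NormedAddCommGroup E] [NormedSpace ℝ E]
    [FiniteDimensional ℝ E] {Ψ : ℝ × ℝ × E × E → E} {U : Set (ℝ × ℝ × E × E)} (hU : IsOpen U)
    (hΨ : ContDiffOn ℝ ∞ Ψ U) {x₀ : E} (h₀ : ∀ w, ((0 : ℝ), (0 : ℝ), x₀, w) ∈ U)
    (hzero : ∀ h x w, (h, (0 : ℝ), x, w) ∈ U → Ψ (h, 0, x, w) = x)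
    (hvel : ∀ h x w, (h, (0 : ℝ), x, w) ∈ U → HasDerivAt (fun t => Ψ (h, t, x, w)) w 0)
    (R : ℝ) {δ : ℝ} (hδ : 0 < δ) :
    ∃ ε > 0, ∀ h t : ℝ, |h| < ε → |t| < ε → ∀ z ∈ ball x₀ ε ×ˢ ball (0 : E) R,
      (h, t, z) ∈ U ∧ ‖Ψ (h, t, z) - z.1 - t • z.2‖ ≤ δ * |t| ∧
      ∀ z' ∈ ball x₀ ε ×ˢ ball (0 : E) R,
        ‖(Ψ (h, t, z) - z.1 - t • z.2) - (Ψ (h, t, z') - z'.1 - t • z'.2)‖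
          ≤ δ * |t| * ‖z - z'‖ := by
  -- The time derivative of the remainder `Ψ(h, t, x, w) - x - t w`.
  set k : ℝ × ℝ × E × E → E := fun p => fderiv ℝ Ψ p (0, 1, 0, 0) - p.2.2.2 with hk
  set ι : E × E →L[ℝ] ℝ × ℝ × E × E :=
    (ContinuousLinearMap.inr ℝ ℝ (ℝ × E × E)).comp (ContinuousLinearMap.inr ℝ ℝ (E × E)) with hι
  have hkC : ContDiffOn ℝ ∞ k U := by
    have h1 : ContDiffOn ℝ ∞ (fderiv ℝ Ψ) U := hΨ.fderiv_of_isOpen hU (by simp)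
    exact (h1.clm_apply contDiffOn_const).sub (by fun_prop)
  have hcurve : ∀ h t z, (h, t, z) ∈ U →
      HasDerivAt (fun t => Ψ (h, t, z)) (k (h, t, z) + z.2) t := by
    intro h t z hp
    have h1 : HasFDerivAt Ψ (fderiv ℝ Ψ (h, t, z)) (h, t, z) :=
      ((hΨ.contDiffAt (hU.mem_nhds hp)).differentiableAt (by simp)).hasFDerivAt
    have h2 : HasDerivAt (fun t : ℝ => (h, t, z)) ((0 : ℝ), (1 : ℝ), (0 : E × E)) t :=
      (hasDerivAt_const t h).prodMk ((hasDerivAt_id t).prodMk (hasDerivAt_const t z))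
    have h3 := h1.comp_hasDerivAt t h2
    have e : k (h, t, z) + z.2 = fderiv ℝ Ψ (h, t, z) (0, 1, 0) := sub_add_cancel _ _
    rw [e]
    exact h3
  have hk0 : ∀ h z, (h, (0 : ℝ), z) ∈ U → k (h, 0, z) = 0 := by
    intro h z hp
    have := (hcurve h 0 z hp).unique (hvel h z.1 z.2 hp)
    simpa using this
  have hkι : ∀ h t z, (h, t, z) ∈ U →
      HasFDerivAt (fun z => k (h, t, z)) ((fderiv ℝ k (h, t, z)).comp ι) z := by
    intro h t z hp
    have h1 : HasFDerivAt k (fderiv ℝ k (h, t, z)) (h, t, z) :=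
      ((hkC.contDiffAt (hU.mem_nhds hp)).differentiableAt (by simp)).hasFDerivAt
    have h2 : HasFDerivAt (fun z : E × E => (h, t, z)) ι z := by
      have h3 : HasFDerivAt (fun z : E × E => ((0 : ℝ), (0 : ℝ), z) + (h, t, (0 : E × E))) ι z :=
        ι.hasFDerivAt.add_const _
      simpa using h3
    exact h1.comp z h2
  -- `k` vanishes on the whole slice `t = 0`, hence so does its derivative along the slice.
  have hDk0 : ∀ h z, (h, (0 : ℝ), z) ∈ U → (fderiv ℝ k (h, 0, z)).comp ι = 0 := by
    intro h z hp
    refine (hkι h 0 z hp).unique ?_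
    have hev : ∀ᶠ z' in 𝓝 z, (h, (0 : ℝ), z') ∈ U :=
      (by fun_prop : ContinuousAt (fun z' : E × E => (h, (0 : ℝ), z')) z).eventually
        (hU.mem_nhds hp)
    exact (hasFDerivAt_const (0 : E) z).congr_of_eventuallyEq
      (hev.mono fun z' hz' => hk0 h z' hz')
  set S : Set (ℝ × ℝ × E × E) :=
    (U ∩ (fun p => ‖k p‖) ⁻¹' Iio δ) ∩ (U ∩ (fun p => ‖(fderiv ℝ k p).comp ι‖) ⁻¹' Iio δ) with hS
  have hSo : IsOpen S := by
    refine IsOpen.inter (hkC.continuousOn.norm.isOpen_inter_preimage hU isOpen_Iio) ?_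
    refine ContinuousOn.isOpen_inter_preimage ?_ hU isOpen_Iio
    have h1 : ContinuousOn (fderiv ℝ k) U :=
      (hkC.fderiv_of_isOpen (m := 0) hU (by simp)).continuousOn
    exact (h1.clm_comp continuousOn_const).norm
  set C : Set (ℝ × ℝ × E × E) := {0} ×ˢ {0} ×ˢ {x₀} ×ˢ closedBall (0 : E) R with hC
  have hCc : IsCompact C := isCompact_singleton.prod (isCompact_singleton.prod
    (isCompact_singleton.prod (isCompact_closedBall _ _)))
  have hCS : C ⊆ S := by
    rintro ⟨h, t, x, w⟩ ⟨h1, h2, h3, -⟩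
    simp only [mem_singleton_iff] at h1 h2 h3
    subst h1 h2 h3
    refine ⟨⟨h₀ w, ?_⟩, ⟨h₀ w, ?_⟩⟩
    · simp [hk0 _ _ (h₀ w), hδ]
    · simp [hDk0 _ _ (h₀ w), hδ]
  -- Compactness in `w` makes `ε` uniform; comparison with the point of `C` having the same `w`
  -- keeps the full radius `R` in the fibre.
  obtain ⟨ε, hε, hεS⟩ := hCc.exists_thickening_subset_open hSo hCS
  have hbox : ∀ h t : ℝ, |h| < ε → |t| < ε → ∀ z ∈ ball x₀ ε ×ˢ ball (0 : E) R,
      (h, t, z) ∈ S := by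
    rintro h t hh ht ⟨x, w⟩ ⟨hx, hw⟩
    refine hεS (mem_thickening_iff.2 ⟨(0, 0, x₀, w),
      ⟨rfl, rfl, rfl, ball_subset_closedBall hw⟩, ?_⟩)
    simp only [Prod.dist_eq, dist_self, max_lt_iff]
    simp only [mem_ball] at hx
    exact ⟨by simpa using hh, by simpa using ht, hx, hε⟩
  have hconv : Convex ℝ (ball x₀ ε ×ˢ ball (0 : E) R) := (convex_ball _ _).prod (convex_ball _ _)
  have hklip : ∀ h t : ℝ, |h| < ε → |t| < ε → ∀ z ∈ ball x₀ ε ×ˢ ball (0 : E) R,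
      ∀ z' ∈ ball x₀ ε ×ˢ ball (0 : E) R, ‖k (h, t, z) - k (h, t, z')‖ ≤ δ * ‖z - z'‖ := by
    intro h t hh ht z hz z' hz'
    exact hconv.norm_image_sub_le_of_norm_hasFDerivWithin_le
      (fun y hy => (hkι h t y (hbox h t hh ht y hy).1.1).hasFDerivWithinAt)
      (fun y hy => (hbox h t hh ht y hy).2.2.le) hz' hz
  have habs : ∀ {t : ℝ}, |t| < ε → t ∈ Ioo (-ε) ε := fun ht => abs_lt.1 ht
  have hg : ∀ h t : ℝ, |h| < ε → |t| < ε → ∀ z ∈ ball x₀ ε ×ˢ ball (0 : E) R,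
      HasDerivAt (fun t => Ψ (h, t, z) - z.1 - t • z.2) (k (h, t, z)) t := by
    intro h t hh ht z hz
    simpa using ((hcurve h t z (hbox h t hh ht z hz).1.1).sub_const z.1).fun_sub
      ((hasDerivAt_id t).smul_const z.2)
  refine ⟨ε, hε, fun h t hh ht z hz => ⟨(hbox h t hh ht z hz).1.1, ?_, fun z' hz' => ?_⟩⟩
  · have := (convex_Ioo (-ε) ε).norm_image_sub_le_of_norm_hasDerivWithin_le
      (fun s hs => (hg h s hh (abs_lt.2 hs) z hz).hasDerivWithinAt)
      (fun s hs => (hbox h s hh (abs_lt.2 hs) z hz).1.2.le)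
      (habs (by simpa using hε) : (0 : ℝ) ∈ _) (habs ht)
    simpa [hzero h z.1 z.2 (hbox h 0 hh (by simpa using hε) z hz).1.1] using this
  · have := (convex_Ioo (-ε) ε).norm_image_sub_le_of_norm_hasDerivWithin_le
      (fun s hs => ((hg h s hh (abs_lt.2 hs) z hz).sub
        (hg h s hh (abs_lt.2 hs) z' hz')).hasDerivWithinAt)
      (fun s hs => hklip h s hh (abs_lt.2 hs) z hz z' hz')
      (habs (by simpa using hε) : (0 : ℝ) ∈ _) (habs ht)
    have e1 := hzero h z.1 z.2 (hbox h 0 hh (by simpa using hε) z hz).1.1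
    have e2 := hzero h z'.1 z'.2 (hbox h 0 hh (by simpa using hε) z' hz').1.1
    simp only [Prod.mk.eta] at e1 e2
    simp only [Pi.sub_apply, e1, e2, zero_smul, sub_self, sub_zero, Real.norm_eq_abs] at this
    linarith

/-- The pair of boundary values of `Ψ` at the times `m ≤ 0 ≤ p` as a base point together with the
difference quotient of step `h`. -/
noncomputable def rescaledPair {E : Type*} [NormedAddCommGroup E] [NormedSpace ℝ E]
    (Ψ : ℝ × ℝ × E × E → E) (h p m : ℝ) (z : E × E) : E × E :=
  (Ψ (h, m, z), h⁻¹ • (Ψ (h, p, z) - Ψ (h, m, z)))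

/-- Division by `h` costs nothing, because the two remainders are bounded by `δ|p|` and `δ|m|` and
the signs of the times force `|p| + |m| = h`. -/
theorem exists_rescaledPair_approx {E : Type*} [NormedAddCommGroup E] [NormedSpace ℝ E]
    [FiniteDimensional ℝ E] {Ψ : ℝ × ℝ × E × E → E} {U : Set (ℝ × ℝ × E × E)} (hU : IsOpen U)
    (hΨ : ContDiffOn ℝ ∞ Ψ U) {x₀ : E} (h₀ : ∀ w, ((0 : ℝ), (0 : ℝ), x₀, w) ∈ U)
    (hzero : ∀ h x w, (h, (0 : ℝ), x, w) ∈ U → Ψ (h, 0, x, w) = x)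
    (hvel : ∀ h x w, (h, (0 : ℝ), x, w) ∈ U → HasDerivAt (fun t => Ψ (h, t, x, w)) w 0)
    (R : ℝ) {δ : ℝ} (hδ : 0 < δ) :
    ∃ ε > 0, ∀ h p m : ℝ, 0 < h → h < ε → 0 ≤ p → m ≤ 0 → p - m = h →
      ∀ z ∈ ball x₀ ε ×ˢ ball (0 : E) R,
      (h, p, z) ∈ U ∧ (h, m, z) ∈ U ∧ ‖rescaledPair Ψ h p m z - z‖ ≤ δ ∧
      ∀ z' ∈ ball x₀ ε ×ˢ ball (0 : E) R,
        ‖rescaledPair Ψ h p m z - rescaledPair Ψ h p m z' - (z - z')‖ ≤ δ * ‖z - z'‖ := by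
  obtain ⟨ε, hε, H⟩ := exists_remainder_lipschitz hU hΨ h₀ hzero hvel R hδ
  have hc : 0 < δ + |R| + 1 := by positivity
  -- The base component carries the extra term `m • w`, of size at most `h |R|` and Lipschitz
  -- constant at most `h`; the second bound on `h` absorbs both.
  refine ⟨min ε (δ / (δ + |R| + 1)), by positivity, fun h p m hh hhε hp hm hpm z hz => ?_⟩
  have hhε1 : h < ε := hhε.trans_le (min_le_left _ _)
  have hsmall : h * (δ + |R| + 1) ≤ δ :=
    ((le_div_iff₀ hc).1 (hhε.le.trans (min_le_right _ _)))
  have hsub : ball x₀ (min ε (δ / (δ + |R| + 1))) ×ˢ ball (0 : E) R ⊆ ball x₀ ε ×ˢ ball 0 R :=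
    prod_mono (ball_subset_ball (min_le_left _ _)) subset_rfl
  have hha : |h| < ε := by rwa [abs_of_pos hh]
  have hpa : |p| = p := abs_of_nonneg hp
  have hma : |m| = -m := abs_of_nonpos hm
  have hmh : |m| ≤ h := by linarith
  have hpε : |p| < ε := by linarith
  have hmε : |m| < ε := by linarith
  set g : ℝ → E × E → E := fun t z => Ψ (h, t, z) - z.1 - t • z.2 with hg
  have hF : ∀ z, rescaledPair Ψ h p m z - z = (g m z + m • z.2, h⁻¹ • (g p z - g m z)) := by
    intro z
    have : h⁻¹ • (p • z.2 - m • z.2) = z.2 := by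
      rw [← sub_smul, hpm, smul_smul, inv_mul_cancel₀ hh.ne', one_smul]
    ext1
    · simp [rescaledPair, hg]
    · calc h⁻¹ • (Ψ (h, p, z) - Ψ (h, m, z)) - z.2
          = h⁻¹ • (Ψ (h, p, z) - Ψ (h, m, z)) - h⁻¹ • (p • z.2 - m • z.2) := by rw [this]
        _ = h⁻¹ • (g p z - g m z) := by rw [← smul_sub]; congr 1; simp only [hg]; abel
  obtain ⟨hpU, hpn, hpl⟩ := H h p hha hpε z (hsub hz)
  obtain ⟨hmU, hmn, hml⟩ := H h m hha hmε z (hsub hz)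
  have hquot : ∀ (u v : E) (c : ℝ), ‖u‖ ≤ δ * |p| * c → ‖v‖ ≤ δ * |m| * c →
      ‖h⁻¹ • (u - v)‖ ≤ δ * c := by
    intro u v c hu hv
    rw [norm_smul, norm_inv, Real.norm_of_nonneg hh.le, inv_mul_le_iff₀ hh]
    calc ‖u - v‖ ≤ ‖u‖ + ‖v‖ := norm_sub_le _ _
      _ ≤ δ * |p| * c + δ * |m| * c := add_le_add hu hv
      _ = h * (δ * c) := by rw [hpa, hma, ← hpm]; ring
  refine ⟨hpU, hmU, ?_, fun z' hz' => ?_⟩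
  · rw [hF, Prod.norm_def]
    refine max_le ?_ (by simpa using hquot (g p z) (g m z) 1 (by simpa using hpn) (by simpa using hmn))
    have hw : ‖z.2‖ ≤ |R| := (mem_ball_zero_iff.1 hz.2).le.trans (le_abs_self _)
    calc ‖g m z + m • z.2‖ ≤ ‖g m z‖ + ‖m • z.2‖ := norm_add_le _ _
      _ ≤ δ * |m| + |m| * |R| := by
        refine add_le_add hmn ?_
        rw [norm_smul, Real.norm_eq_abs]
        gcongr
      _ = |m| * (δ + |R|) := by ring
      _ ≤ h * (δ + |R| + 1) := mul_le_mul hmh (by linarith) (by positivity) hh.le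
      _ ≤ δ := hsmall
  · have e : rescaledPair Ψ h p m z - rescaledPair Ψ h p m z' - (z - z')
        = (g m z - g m z' + m • (z.2 - z'.2), h⁻¹ • ((g p z - g p z') - (g m z - g m z'))) := by
      rw [sub_sub_sub_comm, hF, hF]
      ext1
      · simp only [Prod.fst_sub, smul_sub]; abel
      · simp only [Prod.snd_sub, ← smul_sub]; congr 1; abel
    rw [e, Prod.norm_def]
    refine max_le ?_ (hquot _ _ _ (hpl z' (hsub hz')) (hml z' (hsub hz')))
    calc ‖g m z - g m z' + m • (z.2 - z'.2)‖ ≤ ‖g m z - g m z'‖ + ‖m • (z.2 - z'.2)‖ :=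
          norm_add_le _ _
      _ ≤ δ * |m| * ‖z - z'‖ + |m| * ‖z - z'‖ := by
        refine add_le_add (hml z' (hsub hz')) ?_
        rw [norm_smul, Real.norm_eq_abs]
        gcongr
        exact norm_snd_le (z - z')
      _ = |m| * (δ + 1) * ‖z - z'‖ := by ring
      _ ≤ h * (δ + |R| + 1) * ‖z - z'‖ := by gcongr; linarith [abs_nonneg R]
      _ ≤ δ * ‖z - z'‖ := by gcongr

/-! ### The discretization in charts of `Q` and `TQ` -/

namespace SmoothDiscretization

variable {E : Type*} [NormedAddCommGroup E] [NormedSpace ℝ E]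
  {Q : Type*} [TopologicalSpace Q] [ChartedSpace E Q] [IsManifold 𝓘(ℝ, E) ∞ Q]

/-- The chart of `TQ` induced by the preferred chart of `Q` at `q`. -/
noncomputable def tangentChart (q : Q) : PartialEquiv (TangentBundle 𝓘(ℝ, E) Q) (E × E) :=
  extChartAt 𝓘(ℝ, E).tangent (⟨q, 0⟩ : TangentBundle 𝓘(ℝ, E) Q)

theorem tangentChart_source (q : Q) :
    (tangentChart (E := E) q).source = {v | v.proj ∈ (chartAt E q).source} := by
  ext v
  simp [tangentChart, TangentBundle.mem_chart_source_iff]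

theorem tangentChart_target (q : Q) :
    (tangentChart (E := E) q).target = (extChartAt 𝓘(ℝ, E) q).target ×ˢ univ := by
  ext z
  have := TangentBundle.mem_chart_target_iff (I := 𝓘(ℝ, E)) z (⟨q, 0⟩ : TangentBundle 𝓘(ℝ, E) Q)
  simp only [tangentChart, OpenPartialHomeomorph.extend, ModelWithCorners.tangent, extChartAt,
    mfld_simps]
  exact this

theorem tangentChart_fst (q : Q) (v : TangentBundle 𝓘(ℝ, E) Q) :
    (tangentChart q v).1 = extChartAt 𝓘(ℝ, E) q v.proj := rfl

theorem tangentChart_snd (q : Q) (v : TangentBundle 𝓘(ℝ, E) Q)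
    (hv : v.proj ∈ (chartAt E q).source) :
    (tangentChart q v).2 = mfderiv 𝓘(ℝ, E) 𝓘(ℝ, E) (extChartAt 𝓘(ℝ, E) q) v.proj v.2 := by
  have := mfderiv_chartAt_eq_tangentCoordChange (I := 𝓘(ℝ, E)) (x := v.proj) (y := q) hv
  exact (congrArg (fun L : E →L[ℝ] E => L v.2) this).symm

theorem tangentChart_symm_proj (q : Q) (z : E × E) :
    ((tangentChart q).symm z).proj = (extChartAt 𝓘(ℝ, E) q).symm z.1 := rfl

/-- The map `ψ` in the chart at `q`. -/
noncomputable def chartRep (D : SmoothDiscretization E Q) (q : Q) (p : ℝ × ℝ × E × E) : E :=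
  extChartAt 𝓘(ℝ, E) q (D.ψ (p.1, p.2.1, (tangentChart q).symm p.2.2))

/-- The domain of `chartRep`. -/
def chartDom (D : SmoothDiscretization E Q) (q : Q) : Set (ℝ × ℝ × E × E) :=
  {p | p.2.2 ∈ (tangentChart (E := E) q).target ∧
    (p.1, p.2.1, (tangentChart q).symm p.2.2) ∈ D.dom ∧
    D.ψ (p.1, p.2.1, (tangentChart q).symm p.2.2) ∈ (chartAt E q).source}

theorem isOpen_chartDom (D : SmoothDiscretization E Q) (q : Q) : IsOpen (D.chartDom q) := by
  have h1 : IsOpen {p : ℝ × ℝ × E × E | p.2.2 ∈ (tangentChart (E := E) q).target} :=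
    (isOpen_extChartAt_target _).preimage (by fun_prop)
  have h2 : ContinuousOn (fun p : ℝ × ℝ × E × E => (p.1, p.2.1, (tangentChart q).symm p.2.2))
      {p : ℝ × ℝ × E × E | p.2.2 ∈ (tangentChart (E := E) q).target} :=
    continuousOn_fst.prodMk ((continuous_fst.comp continuous_snd).continuousOn.prodMk
      ((continuousOn_extChartAt_symm _).comp (continuous_snd.comp continuous_snd).continuousOn
        fun p hp => hp))
  exact h2.isOpen_inter_preimage h1
    (D.smooth_ψ.continuousOn.isOpen_inter_preimage D.isOpen_dom (chartAt E q).open_source)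

theorem contDiffOn_chartRep (D : SmoothDiscretization E Q) (q : Q) :
    ContDiffOn ℝ ∞ (D.chartRep q) (D.chartDom q) := by
  rw [← contMDiffOn_iff_contDiffOn]
  have h1 : ContMDiffOn 𝓘(ℝ, ℝ × ℝ × E × E) (𝓘(ℝ, ℝ).prod (𝓘(ℝ, ℝ).prod (𝓘(ℝ, E).tangent))) ∞
      (fun p : ℝ × ℝ × E × E => (p.1, p.2.1, (tangentChart q).symm p.2.2)) (D.chartDom q) := by
    refine ContMDiffOn.prodMk contDiff_fst.contMDiff.contMDiffOn (ContMDiffOn.prodMk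
      (contDiff_fst.comp contDiff_snd).contMDiff.contMDiffOn ?_)
    exact (contMDiffOn_extChartAt_symm (n := ∞) (I := 𝓘(ℝ, E).tangent)
      (⟨q, 0⟩ : TangentBundle 𝓘(ℝ, E) Q)).comp
      (contDiff_snd.comp contDiff_snd).contMDiff.contMDiffOn fun p hp => hp.1
  have h2 := D.smooth_ψ.comp h1 fun p hp => hp.2.1
  exact (contMDiffOn_extChartAt (I := 𝓘(ℝ, E)) (x := q)).comp h2 fun p hp => hp.2.2

theorem chartRep_zero (D : SmoothDiscretization E Q) (q : Q) (h : ℝ) (x w : E)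
    (hp : (h, (0 : ℝ), x, w) ∈ D.chartDom q) : D.chartRep q (h, 0, x, w) = x := by
  have hx : (x, w) ∈ (tangentChart (E := E) q).target := hp.1
  rw [tangentChart_target] at hx
  simp only [chartRep]
  rw [D.ψ_zero h _ hp.2.1, tangentChart_symm_proj]
  exact (extChartAt 𝓘(ℝ, E) q).right_inv hx.1

theorem hasDerivAt_chartRep (D : SmoothDiscretization E Q) (q : Q) (h : ℝ) (x w : E)
    (hp : (h, (0 : ℝ), x, w) ∈ D.chartDom q) :
    HasDerivAt (fun t => D.chartRep q (h, t, x, w)) w 0 := by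
  set v := (tangentChart (E := E) q).symm (x, w) with hv
  have hsrc : D.ψ (h, 0, v) ∈ (chartAt E q).source := hp.2.2
  have hc : MDifferentiableAt 𝓘(ℝ, ℝ) 𝓘(ℝ, E) (fun t : ℝ => D.ψ (h, t, v)) 0 := by
    have h1 : ContMDiffAt 𝓘(ℝ, ℝ) (𝓘(ℝ, ℝ).prod (𝓘(ℝ, ℝ).prod (𝓘(ℝ, E).tangent))) ∞
        (fun t : ℝ => (h, t, v)) 0 :=
      contMDiffAt_const.prodMk (contMDiffAt_id.prodMk contMDiffAt_const)
    exact ((D.smooth_ψ.contMDiffAt (D.isOpen_dom.mem_nhds hp.2.1)).comp (0 : ℝ) h1).mdifferentiableAt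
      (by simp)
  have hφ : MDifferentiableAt 𝓘(ℝ, E) 𝓘(ℝ, E) (extChartAt 𝓘(ℝ, E) q) (D.ψ (h, 0, v)) :=
    mdifferentiableAt_extChartAt hsrc
  have hcomp : HasFDerivAt (fun t => D.chartRep q (h, t, x, w))
      ((mfderiv 𝓘(ℝ, E) 𝓘(ℝ, E) (extChartAt 𝓘(ℝ, E) q) (D.ψ (h, 0, v)) : E →L[ℝ] E).comp
        (mfderiv 𝓘(ℝ, ℝ) 𝓘(ℝ, E) (fun t : ℝ => D.ψ (h, t, v)) 0 : ℝ →L[ℝ] E)) 0 :=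
    (hφ.hasMFDerivAt.comp (0 : ℝ) hc.hasMFDerivAt).hasFDerivAt
  -- The velocity condition is an equality in `TQ`, so it is read off through the fibre coordinate
  -- of the tangent chart.
  have hw : (tangentChart q (⟨D.ψ (h, 0, v), mfderiv 𝓘(ℝ, ℝ) 𝓘(ℝ, E)
      (fun t : ℝ => D.ψ (h, t, v)) 0 (1 : ℝ)⟩ : TangentBundle 𝓘(ℝ, E) Q)).2 = w := by
    rw [D.velocity_zero h v hp.2.1, hv, (tangentChart (E := E) q).right_inv hp.1]
  obtain ⟨L, hL, hL1⟩ : ∃ L : ℝ →L[ℝ] E,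
      HasFDerivAt (fun t => D.chartRep q (h, t, x, w)) L 0 ∧ L 1 = w :=
    ⟨_, hcomp, (tangentChart_snd q _ hsrc).symm.trans hw⟩
  exact hL1 ▸ hL.hasDerivAt

end SmoothDiscretization

/-! ### Inversion of maps close to the identity -/

/-- The derivative at `z` is within `1/2` of the identity, hence injective, hence invertible in
finite dimension, and the inverse function theorem applies. -/
theorem exists_contDiffAt_right_inverse {E : Type*} [NormedAddCommGroup E] [NormedSpace ℝ E]
    [FiniteDimensional ℝ E] {F : E → E} {s : Set E} {z : E} (hs : s ∈ 𝓝 z)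
    (hF : ContDiffAt ℝ ∞ F z)
    (hlip : ∀ x ∈ s, ∀ y ∈ s, ‖F x - F y - (x - y)‖ ≤ 1 / 2 * ‖x - y‖) :
    ∃ G : E → E, ContDiffAt ℝ ∞ G (F z) ∧ G (F z) = z ∧ ∀ᶠ y in 𝓝 (F z), F (G y) = y := by
  have hF' : HasFDerivAt F (fderiv ℝ F z) z := (hF.differentiableAt (by simp)).hasFDerivAt
  have hle : ‖fderiv ℝ F z - ContinuousLinearMap.id ℝ E‖ ≤ 1 / 2 := by
    have h1 : HasFDerivAt (fun x => F x - x) (fderiv ℝ F z - ContinuousLinearMap.id ℝ E) z :=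
      hF'.sub (hasFDerivAt_id z)
    have h2 : LipschitzOnWith (1 / 2) (fun x => F x - x) s :=
      LipschitzOnWith.of_dist_le_mul fun x hx y hy => by
        simpa [dist_eq_norm, sub_sub_sub_comm] using hlip x hx y hy
    simpa using h1.le_of_lipschitzOn hs h2
  have hinj : Function.Injective (fderiv ℝ F z : E →ₗ[ℝ] E) := by
    rw [← LinearMap.ker_eq_bot, LinearMap.ker_eq_bot']
    intro x hx
    have h3 := (fderiv ℝ F z - ContinuousLinearMap.id ℝ E).le_of_opNorm_le hle x
    have hx' : fderiv ℝ F z x = 0 := hx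
    rw [sub_apply, hx', zero_sub, norm_neg, ContinuousLinearMap.id_apply] at h3
    exact norm_le_zero_iff.1 (by linarith)
  set A : E ≃L[ℝ] E := (LinearEquiv.ofInjectiveEndo _ hinj).toContinuousLinearEquiv with hA
  have hAF : HasFDerivAt F (A : E →L[ℝ] E) z := by
    have : (A : E →L[ℝ] E) = fderiv ℝ F z := by ext x; rfl
    rwa [this]
  refine ⟨hF.localInverse hAF (by simp), hF.to_localInverse hAF (by simp),
    hF.localInverse_apply_image hAF (by simp), ?_⟩
  exact (hF.hasStrictFDerivAt' hAF (by simp)).eventually_right_inverse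

/-- A perturbation of the identity with Lipschitz constant `1/2` maps a ball of radius `ρ` onto a
set containing the ball of radius `(1 - 1/2) ρ` about the image of the centre. -/
theorem exists_eq_of_approx_id {E : Type*} [NormedAddCommGroup E] [NormedSpace ℝ E]
    [CompleteSpace E] {F : E → E} {s : Set E} {z y : E} {ρ : ℝ} (hρ : 0 ≤ ρ)
    (hs : closedBall z ρ ⊆ s)
    (hlip : ∀ x ∈ s, ∀ y ∈ s, ‖F x - F y - (x - y)‖ ≤ 1 / 2 * ‖x - y‖)
    (hy : ‖y - F z‖ ≤ ρ / 2) : ∃ x ∈ closedBall z ρ, F x = y := by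
  have happ : ApproximatesLinearOn F (ContinuousLinearEquiv.refl ℝ E : E →L[ℝ] E) s (1 / 2) :=
    fun x hx y hy => by simpa using hlip x hx y hy
  let S : (ContinuousLinearEquiv.refl ℝ E : E →L[ℝ] E).NonlinearRightInverse :=
    { toFun := id, nnnorm := 1, bound' := fun y => by simp, right_inv' := fun y => rfl }
  refine happ.surjOn_closedBall_of_nonlinearRightInverse S hρ hs ?_
  rw [mem_closedBall, dist_eq_norm]
  refine hy.trans (le_of_eq ?_)
  simp only [S]
  norm_num
  ring

/-! ### Local properties of the boundary maps for small step -/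

namespace SmoothDiscretization

variable {E : Type*} [NormedAddCommGroup E] [NormedSpace ℝ E]
  {Q : Type*} [TopologicalSpace Q] [ChartedSpace E Q] [IsManifold 𝓘(ℝ, E) ∞ Q]

/-- The pair of boundary maps `(∂⁺_h, ∂⁻_h)`. -/
def bdPair (D : SmoothDiscretization E Q) (h : ℝ) (v : TangentBundle 𝓘(ℝ, E) Q) : Q × Q :=
  (D.bdPlus h v, D.bdMinus h v)

theorem αp_nonneg (D : SmoothDiscretization E Q) {h : ℝ} (h0 : 0 < h) (ha : h < D.a) :
    0 ≤ D.αp h :=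
  nonneg_of_mul_nonneg_right (D.αp_sign h ⟨by linarith [D.a_pos], ha⟩) h0

theorem αm_nonpos (D : SmoothDiscretization E Q) {h : ℝ} (h0 : 0 < h) (ha : h < D.a) :
    D.αm h ≤ 0 := by
  have := D.αm_sign h ⟨by linarith [D.a_pos], ha⟩
  by_contra! hc
  linarith [mul_pos h0 hc]

theorem αp_sub_αm' (D : SmoothDiscretization E Q) {h : ℝ} (h0 : 0 < h) (ha : h < D.a) :
    D.αp h - D.αm h = h := D.αp_sub_αm h ⟨by linarith [D.a_pos], ha⟩

theorem eventually_mem_Ioo (D : SmoothDiscretization E Q) : ∀ᶠ h in 𝓝[>] (0 : ℝ), h ∈ Ioo 0 D.a :=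
  Ioo_mem_nhdsGT D.a_pos

theorem tendsto_αp (D : SmoothDiscretization E Q) : Tendsto D.αp (𝓝[>] 0) (𝓝 0) := by
  refine tendsto_of_tendsto_of_tendsto_of_le_of_le' tendsto_const_nhds
    (tendsto_id.mono_right nhdsWithin_le_nhds) ?_ ?_ <;>
  filter_upwards [D.eventually_mem_Ioo] with h hh
  · exact D.αp_nonneg hh.1 hh.2
  · have := D.αm_nonpos hh.1 hh.2
    have := D.αp_sub_αm' hh.1 hh.2
    simp only [id]
    linarith

theorem tendsto_αm (D : SmoothDiscretization E Q) : Tendsto D.αm (𝓝[>] 0) (𝓝 0) := by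
  have h1 : Tendsto (fun h => D.αp h - h) (𝓝[>] 0) (𝓝 0) := by
    simpa using D.tendsto_αp.sub (tendsto_id.mono_right (nhdsWithin_le_nhds (s := Ioi (0 : ℝ))))
  refine h1.congr' ?_
  filter_upwards [D.eventually_mem_Ioo] with h hh
  linarith [D.αp_sub_αm' hh.1 hh.2]

theorem tendsto_ψ (D : SmoothDiscretization E Q) {α : ℝ → ℝ} (hα : Tendsto α (𝓝[>] 0) (𝓝 0))
    (v₀ : TangentBundle 𝓘(ℝ, E) Q) :
    Tendsto (fun p : ℝ × TangentBundle 𝓘(ℝ, E) Q => D.ψ (p.1, α p.1, p.2))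
      (𝓝[>] 0 ×ˢ 𝓝 v₀) (𝓝 v₀.proj) := by
  have hc : ContinuousAt D.ψ (0, 0, v₀) :=
    D.smooth_ψ.continuousOn.continuousAt (D.isOpen_dom.mem_nhds (D.zero_mem_dom v₀))
  have h1 : Tendsto (fun p : ℝ × TangentBundle 𝓘(ℝ, E) Q => (p.1, α p.1, p.2))
      (𝓝[>] 0 ×ˢ 𝓝 v₀) (𝓝 (0, 0, v₀)) :=
    (tendsto_fst.mono_right nhdsWithin_le_nhds).prodMk_nhds
      ((hα.comp tendsto_fst).prodMk_nhds tendsto_snd)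
  have h2 := hc.tendsto.comp h1
  rwa [D.ψ_zero 0 v₀ (D.zero_mem_dom v₀)] at h2

theorem tendsto_bdPair (D : SmoothDiscretization E Q) (v₀ : TangentBundle 𝓘(ℝ, E) Q) :
    Tendsto (fun p : ℝ × TangentBundle 𝓘(ℝ, E) Q => D.bdPair p.1 p.2)
      (𝓝[>] 0 ×ˢ 𝓝 v₀) (𝓝 (v₀.proj, v₀.proj)) :=
  (D.tendsto_ψ D.tendsto_αp v₀).prodMk_nhds (D.tendsto_ψ D.tendsto_αm v₀)

/-- The pair of boundary maps in the chart at `q`, in rescaled form. -/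
noncomputable def chartPair (D : SmoothDiscretization E Q) (q : Q) (h : ℝ) : E × E → E × E :=
  rescaledPair (D.chartRep q) h (D.αp h) (D.αm h)

theorem chartPair_tangentChart (D : SmoothDiscretization E Q) (q : Q) (h : ℝ)
    {v : TangentBundle 𝓘(ℝ, E) Q} (hv : v ∈ (tangentChart q).source) :
    D.chartPair q h (tangentChart q v) =
      (extChartAt 𝓘(ℝ, E) q (D.bdPair h v).2,
        h⁻¹ • (extChartAt 𝓘(ℝ, E) q (D.bdPair h v).1 - extChartAt 𝓘(ℝ, E) q (D.bdPair h v).2)) := by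
  simp [chartPair, rescaledPair, chartRep, (tangentChart q).left_inv hv, bdPair, bdPlus, bdMinus]

theorem bdPair_tangentChart_symm (D : SmoothDiscretization E Q) (q : Q) {h : ℝ} (hh : h ≠ 0)
    {z : E × E} (hp : (h, D.αp h, z) ∈ D.chartDom q) (hm : (h, D.αm h, z) ∈ D.chartDom q)
    {w : Q × Q} (hw₁ : w.1 ∈ (chartAt E q).source) (hw₂ : w.2 ∈ (chartAt E q).source)
    (hz : D.chartPair q h z = (extChartAt 𝓘(ℝ, E) q w.2,
      h⁻¹ • (extChartAt 𝓘(ℝ, E) q w.1 - extChartAt 𝓘(ℝ, E) q w.2))) :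
    D.bdPair h ((tangentChart q).symm z) = w := by
  have hinj := (extChartAt 𝓘(ℝ, E) q).injOn
  rw [extChartAt_source] at hinj
  obtain ⟨e1, e2⟩ := Prod.ext_iff.1 hz
  simp only [chartPair, rescaledPair] at e1 e2
  rw [e1] at e2
  have e3 := sub_left_injective (smul_right_injective E (inv_ne_zero hh) e2)
  exact Prod.ext (hinj hp.2.2 hw₁ e3) (hinj hm.2.2 hw₂ e1)

theorem tangentChart_preimage_mem_nhds {v₀ : TangentBundle 𝓘(ℝ, E) Q} {q : Q}
    (hq : v₀.proj = q) {s : Set (E × E)} (hs : s ∈ 𝓝 (tangentChart q v₀)) :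
    (tangentChart q).source ∩ tangentChart q ⁻¹' s ∈ 𝓝 v₀ := by
  have hsrc : v₀ ∈ (tangentChart q).source := by
    rw [tangentChart_source]
    simp [hq]
  exact inter_mem ((isOpen_extChartAt_source _).mem_nhds hsrc)
    ((continuousAt_extChartAt' hsrc).preimage_mem_nhds hs)

theorem tangentChart_box_mem_nhds {v₀ : TangentBundle 𝓘(ℝ, E) Q} {q : Q} (hq : v₀.proj = q)
    {ε R : ℝ} (hε : 0 < ε) (hR : ‖(tangentChart q v₀).2‖ < R) :
    ball (extChartAt 𝓘(ℝ, E) q q) ε ×ˢ ball (0 : E) R ∈ 𝓝 (tangentChart q v₀) := by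
  refine (isOpen_ball.prod isOpen_ball).mem_nhds ⟨?_, by simpa using hR⟩
  rw [tangentChart_fst, hq]
  exact mem_ball_self hε

theorem contDiffAt_chartPair (D : SmoothDiscretization E Q) (q : Q) {h : ℝ} {z : E × E}
    (hp : (h, D.αp h, z) ∈ D.chartDom q) (hm : (h, D.αm h, z) ∈ D.chartDom q) :
    ContDiffAt ℝ ∞ (D.chartPair q h) z := by
  have key : ∀ t, (h, t, z) ∈ D.chartDom q →
      ContDiffAt ℝ ∞ (fun z => D.chartRep q (h, t, z)) z := fun t ht =>
    ContDiffAt.comp (g := D.chartRep q) (f := fun z => (h, t, z)) z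
      ((D.contDiffOn_chartRep q).contDiffAt ((D.isOpen_chartDom q).mem_nhds ht))
      (contDiffAt_const.prodMk (contDiffAt_const.prodMk contDiffAt_id))
  exact (key _ hm).prodMk (((key _ hp).sub (key _ hm)).const_smul _)

variable [FiniteDimensional ℝ E]

theorem exists_chartPair_approx (D : SmoothDiscretization E Q) (q : Q) (R : ℝ) {δ : ℝ}
    (hδ : 0 < δ) :
    ∃ ε > 0, ∀ h ∈ Ioo 0 ε, h < D.a ∧
      ∀ z ∈ ball (extChartAt 𝓘(ℝ, E) q q) ε ×ˢ ball (0 : E) R,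
      (h, D.αp h, z) ∈ D.chartDom q ∧ (h, D.αm h, z) ∈ D.chartDom q ∧
      ‖D.chartPair q h z - z‖ ≤ δ ∧
      ∀ z' ∈ ball (extChartAt 𝓘(ℝ, E) q q) ε ×ˢ ball (0 : E) R,
        ‖D.chartPair q h z - D.chartPair q h z' - (z - z')‖ ≤ δ * ‖z - z'‖ := by
  have h₀ : ∀ w : E, ((0 : ℝ), (0 : ℝ), extChartAt 𝓘(ℝ, E) q q, w) ∈ D.chartDom q := by
    intro w
    refine ⟨?_, D.zero_mem_dom _, ?_⟩
    · rw [tangentChart_target]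
      exact ⟨mem_extChartAt_target q, mem_univ _⟩
    · rw [D.ψ_zero _ _ (D.zero_mem_dom _), tangentChart_symm_proj]
      simp
  obtain ⟨ε, hε, H⟩ := exists_rescaledPair_approx (D.isOpen_chartDom q) (D.contDiffOn_chartRep q)
    h₀ (D.chartRep_zero q) (D.hasDerivAt_chartRep q) R hδ
  refine ⟨min ε D.a, lt_min hε D.a_pos, fun h hh => ?_⟩
  have ha : h < D.a := hh.2.trans_le (min_le_right _ _)
  have hsub : ball (extChartAt 𝓘(ℝ, E) q q) (min ε D.a) ×ˢ ball (0 : E) R ⊆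
      ball (extChartAt 𝓘(ℝ, E) q q) ε ×ˢ ball 0 R :=
    prod_mono (ball_subset_ball (min_le_left _ _)) subset_rfl
  refine ⟨ha, fun z hz => ?_⟩
  obtain ⟨h1, h2, h3, h4⟩ := H h _ _ hh.1 (hh.2.trans_le (min_le_left _ _)) (D.αp_nonneg hh.1 ha)
    (D.αm_nonpos hh.1 ha) (D.αp_sub_αm' hh.1 ha) z (hsub hz)
  exact ⟨h1, h2, h3, fun z' hz' => h4 z' (hsub hz')⟩

/-- Stated near a pair of vectors, so that compactness of `K ×ˢ K` turns it into injectivity on `K`.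
-/
theorem eventually_injective (D : SmoothDiscretization E Q) [T2Space Q]
    (v₀ v₁ : TangentBundle 𝓘(ℝ, E) Q) :
    ∀ᶠ p : ℝ × TangentBundle 𝓘(ℝ, E) Q × TangentBundle 𝓘(ℝ, E) Q in 𝓝[>] 0 ×ˢ 𝓝 (v₀, v₁),
      D.bdPair p.1 p.2.1 = D.bdPair p.1 p.2.2 → p.2.1 = p.2.2 := by
  rw [nhds_prod_eq]
  by_cases hq : v₀.proj = v₁.proj
  -- Over a common base point, one chart box contains both vectors, and there the rescaled pair is
  -- injective.
  · set q := v₁.proj with hqdef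
    set R := max ‖(tangentChart q v₀).2‖ ‖(tangentChart q v₁).2‖ + 1
    obtain ⟨ε, hε, H⟩ := D.exists_chartPair_approx q R (δ := 1 / 2) (by norm_num)
    have hn₀ := tangentChart_preimage_mem_nhds hq (tangentChart_box_mem_nhds (R := R) hq hε
      (by linarith [le_max_left ‖(tangentChart q v₀).2‖ ‖(tangentChart q v₁).2‖]))
    have hn₁ := tangentChart_preimage_mem_nhds hqdef.symm (tangentChart_box_mem_nhds (R := R)
      hqdef.symm hε (by linarith [le_max_right ‖(tangentChart q v₀).2‖ ‖(tangentChart q v₁).2‖]))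
    filter_upwards [prod_mem_prod (Ioo_mem_nhdsGT hε) (prod_mem_prod hn₀ hn₁)]
    rintro ⟨h, v, v'⟩ ⟨hh, hv, hv'⟩ heq
    have h1 := ((H h hh).2 _ hv.2).2.2.2 _ hv'.2
    rw [D.chartPair_tangentChart q h hv.1, D.chartPair_tangentChart q h hv'.1] at h1
    simp only at heq
    rw [heq, sub_self, zero_sub, norm_neg] at h1
    exact (tangentChart q).injOn hv.1 hv'.1
      (sub_eq_zero.1 (norm_le_zero_iff.1 (by linarith)))
  -- Over distinct base points, the values of `∂⁺_h` tend to distinct limits, which the Hausdorff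
  -- property separates.
  · have h0 : Tendsto (fun p : ℝ × TangentBundle 𝓘(ℝ, E) Q × TangentBundle 𝓘(ℝ, E) Q =>
        (D.bdPair p.1 p.2.1).1) (𝓝[>] 0 ×ˢ (𝓝 v₀ ×ˢ 𝓝 v₁)) (𝓝 v₀.proj) :=
      (D.tendsto_ψ D.tendsto_αp v₀).comp (tendsto_fst.prodMk (tendsto_fst.comp tendsto_snd))
    have h1 : Tendsto (fun p : ℝ × TangentBundle 𝓘(ℝ, E) Q × TangentBundle 𝓘(ℝ, E) Q =>
        (D.bdPair p.1 p.2.2).1) (𝓝[>] 0 ×ˢ (𝓝 v₀ ×ˢ 𝓝 v₁)) (𝓝 v₁.proj) :=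
      (D.tendsto_ψ D.tendsto_αp v₁).comp (tendsto_fst.prodMk (tendsto_snd.comp tendsto_snd))
    filter_upwards [(h0.prodMk_nhds h1).eventually
      (isClosed_diagonal.isOpen_compl.mem_nhds hq)] with p hp heq
    exact absurd (congrArg Prod.fst heq) hp

/-- The pair of boundary maps is defined at `v` and has a local right inverse through `v` that is
smooth at the image point. -/
def HasSmoothRightInverseAt (D : SmoothDiscretization E Q) (h : ℝ)
    (v : TangentBundle 𝓘(ℝ, E) Q) : Prop :=
  (h, v) ∈ D.domPlus ∧ (h, v) ∈ D.domMinus ∧ ∃ g : Q × Q → TangentBundle 𝓘(ℝ, E) Q,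
    ContMDiffAt (𝓘(ℝ, E).prod 𝓘(ℝ, E)) 𝓘(ℝ, E).tangent ∞ g (D.bdPair h v) ∧
    g (D.bdPair h v) = v ∧ ∀ᶠ w in 𝓝 (D.bdPair h v), D.bdPair h (g w) = w

theorem eventually_hasSmoothRightInverseAt (D : SmoothDiscretization E Q)
    (v₀ : TangentBundle 𝓘(ℝ, E) Q) :
    ∀ᶠ p : ℝ × TangentBundle 𝓘(ℝ, E) Q in 𝓝[>] 0 ×ˢ 𝓝 v₀,
      D.HasSmoothRightInverseAt p.1 p.2 := by
  set q := v₀.proj with hq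
  set R := ‖(tangentChart q v₀).2‖ + 1
  obtain ⟨ε, hε, H⟩ := D.exists_chartPair_approx q R (δ := 1 / 2) (by norm_num)
  have hn₀ := tangentChart_preimage_mem_nhds hq.symm (tangentChart_box_mem_nhds (R := R)
    hq.symm hε (lt_add_one _))
  filter_upwards [prod_mem_prod (Ioo_mem_nhdsGT hε) hn₀]
  rintro ⟨h, v⟩ ⟨hh, hv, hvbox⟩
  obtain ⟨ha, H⟩ := H h hh
  obtain ⟨hp, hm, -, -⟩ := H _ hvbox
  have hIoo : h ∈ Ioo (-D.a) D.a := ⟨by linarith [D.a_pos, hh.1], ha⟩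
  have hl := (tangentChart (E := E) q).left_inv hv
  have hpd : (h, D.αp h, v) ∈ D.dom := by simpa only [hl] using hp.2.1
  have hmd : (h, D.αm h, v) ∈ D.dom := by simpa only [hl] using hm.2.1
  have hps : (D.bdPair h v).1 ∈ (chartAt E q).source := by
    have := hp.2.2
    simp only [hl] at this
    exact this
  have hms : (D.bdPair h v).2 ∈ (chartAt E q).source := by
    have := hm.2.2
    simp only [hl] at this
    exact this
  set z := tangentChart q v with hz
  have hbox : ball (extChartAt 𝓘(ℝ, E) q q) ε ×ˢ ball (0 : E) R ∈ 𝓝 z :=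
    (isOpen_ball.prod isOpen_ball).mem_nhds hvbox
  obtain ⟨G, hG, hGz, hGr⟩ := exists_contDiffAt_right_inverse hbox (D.contDiffAt_chartPair q hp hm)
    fun x hx y hy => (H x hx).2.2.2 y hy
  -- The rescaling of target pairs: in charts `∂^±_h` followed by `L` is `chartPair`, so the local
  -- inverse is `G ∘ L` read back in `TQ`.
  set L : Q × Q → E × E := fun w => (extChartAt 𝓘(ℝ, E) q w.2,
    h⁻¹ • (extChartAt 𝓘(ℝ, E) q w.1 - extChartAt 𝓘(ℝ, E) q w.2)) with hL
  have hLz : L (D.bdPair h v) = D.chartPair q h z := (D.chartPair_tangentChart q h hv).symm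
  have hLs : ContMDiffAt (𝓘(ℝ, E).prod 𝓘(ℝ, E)) 𝓘(ℝ, E × E) ∞ L (D.bdPair h v) := by
    have h1 : ContMDiffAt (𝓘(ℝ, E).prod 𝓘(ℝ, E)) 𝓘(ℝ, E) ∞
        (fun w : Q × Q => extChartAt 𝓘(ℝ, E) q w.1) (D.bdPair h v) :=
      (contMDiffAt_extChartAt' hps).comp _ contMDiffAt_fst
    have h2 : ContMDiffAt (𝓘(ℝ, E).prod 𝓘(ℝ, E)) 𝓘(ℝ, E) ∞
        (fun w : Q × Q => extChartAt 𝓘(ℝ, E) q w.2) (D.bdPair h v) :=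
      (contMDiffAt_extChartAt' hms).comp _ contMDiffAt_snd
    have h3 : ContDiff ℝ ∞ (fun u : E × E => (u.2, h⁻¹ • (u.1 - u.2))) := by fun_prop
    exact h3.contMDiff.contMDiffAt.comp _ (h1.prodMk_space h2)
  have hzt : z ∈ (tangentChart (E := E) q).target := (tangentChart q).map_source hv
  have hes : ContMDiffAt 𝓘(ℝ, E × E) 𝓘(ℝ, E).tangent ∞ (tangentChart (E := E) q).symm z :=
    (contMDiffOn_extChartAt_symm (n := ∞) (I := 𝓘(ℝ, E).tangent)
      (⟨q, 0⟩ : TangentBundle 𝓘(ℝ, E) Q)).contMDiffAt ((isOpen_extChartAt_target _).mem_nhds hzt)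
  have hGL : ContMDiffAt (𝓘(ℝ, E).prod 𝓘(ℝ, E)) 𝓘(ℝ, E × E) ∞ (G ∘ L) (D.bdPair h v) := by
    refine ContMDiffAt.comp _ ?_ hLs
    rw [hLz]
    exact hG.contMDiffAt
  have hGLz : (G ∘ L) (D.bdPair h v) = z := by simp only [Function.comp, hLz, hGz]
  refine ⟨⟨hIoo, hpd⟩, ⟨hIoo, hmd⟩, (tangentChart (E := E) q).symm ∘ (G ∘ L), ?_, ?_, ?_⟩
  · refine ContMDiffAt.comp _ ?_ hGL
    rwa [hGLz]
  · rw [Function.comp_apply, hGLz, hl]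
  · have e1 : ∀ᶠ w in 𝓝 (D.bdPair h v), (G ∘ L) w ∈
        ball (extChartAt 𝓘(ℝ, E) q q) ε ×ˢ ball (0 : E) R :=
      hGL.continuousAt.eventually_mem (by rwa [hGLz])
    have e2 : ∀ᶠ w in 𝓝 (D.bdPair h v), D.chartPair q h (G (L w)) = L w :=
      hLs.continuousAt.eventually (by rwa [hLz])
    have e3 : ∀ᶠ w in 𝓝 (D.bdPair h v),
        w ∈ (chartAt E q).source ×ˢ (chartAt E q).source :=
      ((chartAt E q).open_source.prod (chartAt E q).open_source).mem_nhds ⟨hps, hms⟩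
    filter_upwards [e1, e2, e3] with w hw1 hw2 hw3
    obtain ⟨hp', hm', -, -⟩ := H _ hw1
    exact D.bdPair_tangentChart_symm q hh.1.ne' hp' hm' hw3.1 hw3.2 hw2

/-- After rescaling, the diagonal point `(y, y)` becomes `(y, 0)` in the chart, which is close to
the image of the zero vector at `q`; surjectivity on a small ball gives a preimage. -/
theorem eventually_exists_diagonal (D : SmoothDiscretization E Q) (q : Q)
    {s : Set (TangentBundle 𝓘(ℝ, E) Q)} (hs : s ∈ 𝓝 (⟨q, 0⟩ : TangentBundle 𝓘(ℝ, E) Q)) :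
    ∀ᶠ p : ℝ × Q in 𝓝[>] 0 ×ˢ 𝓝 q, ∃ v ∈ s, D.bdPair p.1 v = (p.2, p.2) := by
  set z₀ : E × E := (extChartAt 𝓘(ℝ, E) q q, 0) with hz₀
  have hz₀t : z₀ ∈ (tangentChart (E := E) q).target := by
    rw [tangentChart_target]
    exact ⟨mem_extChartAt_target q, mem_univ _⟩
  have hz₀s : (tangentChart q).symm z₀ = (⟨q, 0⟩ : TangentBundle 𝓘(ℝ, E) Q) := by
    have h1 : (⟨q, 0⟩ : TangentBundle 𝓘(ℝ, E) Q) ∈ (tangentChart q).source := by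
      rw [tangentChart_source]
      simp
    rw [← (tangentChart q).left_inv h1]
    congr 1
    refine Prod.ext rfl ?_
    rw [tangentChart_snd q _ (mem_chart_source E q)]
    exact (map_zero _).symm
  obtain ⟨ε, hε, H⟩ := D.exists_chartPair_approx q 1 (δ := 1 / 2) (by norm_num)
  have hbox : ball (extChartAt 𝓘(ℝ, E) q q) ε ×ˢ ball (0 : E) 1 ∈ 𝓝 z₀ :=
    (isOpen_ball.prod isOpen_ball).mem_nhds ⟨mem_ball_self hε, mem_ball_self one_pos⟩
  have hs' : (tangentChart q).symm ⁻¹' s ∈ 𝓝 z₀ :=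
    ((continuousOn_extChartAt_symm (I := 𝓘(ℝ, E).tangent)
      (⟨q, 0⟩ : TangentBundle 𝓘(ℝ, E) Q)).continuousAt
        ((isOpen_extChartAt_target _).mem_nhds hz₀t)).preimage_mem_nhds (by rwa [← hz₀s] at hs)
  obtain ⟨ρ, hρ, hρs⟩ := nhds_basis_closedBall.mem_iff.1 (inter_mem hbox hs')
  -- A second use of the estimate, as `ρ` is only known now: `ρ/4` for moving `z₀` and `ρ/4` for
  -- moving `q` to `y` make up the admissible `ρ/2`.
  obtain ⟨ε', hε', H'⟩ := D.exists_chartPair_approx q 1 (δ := ρ / 4) (by positivity)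
  have hq : ∀ᶠ y in 𝓝 q, y ∈ (chartAt E q).source ∧
      ‖extChartAt 𝓘(ℝ, E) q y - extChartAt 𝓘(ℝ, E) q q‖ ≤ ρ / 4 := by
    refine Filter.Eventually.and (chart_source_mem_nhds E q) ?_
    have := (continuousAt_extChartAt (I := 𝓘(ℝ, E)) q).eventually
      (closedBall_mem_nhds _ (show 0 < ρ / 4 by positivity))
    simpa only [mem_closedBall, dist_eq_norm] using this
  filter_upwards [prod_mem_prod (Ioo_mem_nhdsGT (lt_min hε hε')) hq]
  rintro ⟨h, y⟩ ⟨hh, hy, hyn⟩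
  obtain ⟨-, H⟩ := H h ⟨hh.1, hh.2.trans_le (min_le_left _ _)⟩
  have hF := ((H' h ⟨hh.1, hh.2.trans_le (min_le_right _ _)⟩).2 z₀
    ⟨mem_ball_self hε', mem_ball_self one_pos⟩).2.2.1
  obtain ⟨z, hzρ, hz⟩ := exists_eq_of_approx_id (F := D.chartPair q h)
    (y := (extChartAt 𝓘(ℝ, E) q y, (0 : E))) hρ.le
    (hρs.trans inter_subset_left) (fun x hx y hy => (H x hx).2.2.2 y hy) (by
      calc ‖(extChartAt 𝓘(ℝ, E) q y, (0 : E)) - D.chartPair q h z₀‖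
          = ‖(extChartAt 𝓘(ℝ, E) q y - extChartAt 𝓘(ℝ, E) q q, (0 : E))
              - (D.chartPair q h z₀ - z₀)‖ := by congr 1; simp [hz₀, Prod.ext_iff]
        _ ≤ ρ / 4 + ρ / 4 := by
          refine (norm_sub_le _ _).trans (add_le_add ?_ hF)
          simpa [Prod.norm_def] using hyn
        _ = ρ / 2 := by ring)
  obtain ⟨hp, hm, -, -⟩ := H z (hρs hzρ).1
  refine ⟨(tangentChart q).symm z, (hρs hzρ).2, ?_⟩
  exact D.bdPair_tangentChart_symm q hh.1.ne' hp hm hy hy (by simpa using hz)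

end SmoothDiscretization

/-! ### From a good domain to a discrete tangent bundle -/

theorem t2Space_tangentBundle {E : Type*} [NormedAddCommGroup E] [NormedSpace ℝ E]
    {Q : Type*} [TopologicalSpace Q] [T2Space Q] [ChartedSpace E Q] [IsManifold 𝓘(ℝ, E) ∞ Q] :
    T2Space (TangentBundle 𝓘(ℝ, E) Q) := by
  rw [t2Space_iff_disjoint_nhds]
  intro v w hvw
  by_cases hq : v.proj = w.proj
  · have key : ∀ u : TangentBundle 𝓘(ℝ, E) Q, u.proj = w.proj →
        u ∈ (SmoothDiscretization.tangentChart w.proj).source := by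
      intro u hu
      rw [SmoothDiscretization.tangentChart_source]
      simp [hu]
    have hv := key v hq
    have hw := key w rfl
    have hne : SmoothDiscretization.tangentChart w.proj v ≠
        SmoothDiscretization.tangentChart w.proj w := fun h =>
      hvw ((SmoothDiscretization.tangentChart w.proj).injOn hv hw h)
    exact (continuousAt_extChartAt' hv).tendsto.disjoint (disjoint_nhds_nhds.2 hne)
      (continuousAt_extChartAt' hw).tendsto
  · have hc : Continuous (Bundle.TotalSpace.proj : TangentBundle 𝓘(ℝ, E) Q → Q) :=
      FiberBundle.continuous_proj E (TangentSpace 𝓘(ℝ, E))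
    exact (hc.tendsto v).disjoint (disjoint_nhds_nhds.2 hq) (hc.tendsto w)

namespace SmoothDiscretization

variable {E : Type*} [NormedAddCommGroup E] [NormedSpace ℝ E]
  {Q : Type*} [TopologicalSpace Q] [ChartedSpace E Q] [IsManifold 𝓘(ℝ, E) ∞ Q]

theorem contMDiffAt_bdPlus (D : SmoothDiscretization E Q) {h : ℝ}
    {v : TangentBundle 𝓘(ℝ, E) Q} (hv : (h, v) ∈ D.domPlus) :
    ContMDiffAt 𝓘(ℝ, E).tangent 𝓘(ℝ, E) ∞ (D.bdPlus h) v := by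
  have h1 : ContMDiffAt 𝓘(ℝ, E).tangent (𝓘(ℝ, ℝ).prod (𝓘(ℝ, ℝ).prod (𝓘(ℝ, E).tangent))) ∞
      (fun v : TangentBundle 𝓘(ℝ, E) Q => (h, D.αp h, v)) v :=
    contMDiffAt_const.prodMk (contMDiffAt_const.prodMk contMDiffAt_id)
  exact (D.smooth_ψ.contMDiffAt (D.isOpen_dom.mem_nhds hv.2)).comp v h1

theorem contMDiffAt_bdMinus (D : SmoothDiscretization E Q) {h : ℝ}
    {v : TangentBundle 𝓘(ℝ, E) Q} (hv : (h, v) ∈ D.domMinus) :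
    ContMDiffAt 𝓘(ℝ, E).tangent 𝓘(ℝ, E) ∞ (D.bdMinus h) v := by
  have h1 : ContMDiffAt 𝓘(ℝ, E).tangent (𝓘(ℝ, ℝ).prod (𝓘(ℝ, ℝ).prod (𝓘(ℝ, E).tangent))) ∞
      (fun v : TangentBundle 𝓘(ℝ, E) Q => (h, D.αm h, v)) v :=
    contMDiffAt_const.prodMk (contMDiffAt_const.prodMk contMDiffAt_id)
  exact (D.smooth_ψ.contMDiffAt (D.isOpen_dom.mem_nhds hv.2)).comp v h1

theorem tangentChart_zero (q x : Q) (hx : x ∈ (chartAt E q).source) :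
    (tangentChart q (⟨x, 0⟩ : TangentBundle 𝓘(ℝ, E) Q)).2 = 0 := by
  rw [tangentChart_snd q _ hx]
  exact map_zero _

theorem isOpen_setOf_bdPair_mem (D : SmoothDiscretization E Q) {h : ℝ}
    {s : Set (TangentBundle 𝓘(ℝ, E) Q)} (hs : IsOpen s)
    (hD : ∀ v ∈ s, D.HasSmoothRightInverseAt h v) (Q₀ : TopologicalSpace.Opens Q) :
    IsOpen {v ∈ s | D.bdPlus h v ∈ Q₀ ∧ D.bdMinus h v ∈ Q₀} := by
  rw [isOpen_iff_mem_nhds]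
  rintro v ⟨hv, hp, hm⟩
  have h1 := (D.contMDiffAt_bdPlus (hD v hv).1).continuousAt.eventually (Q₀.isOpen.mem_nhds hp)
  have h2 := (D.contMDiffAt_bdMinus (hD v hv).2.1).continuousAt.eventually (Q₀.isOpen.mem_nhds hm)
  filter_upwards [hs.mem_nhds hv, h1, h2] with u hu hup hum using ⟨hu, hup, hum⟩

/-- The boundary maps restrict to `V` with values in `Q₀`, are jointly injective and locally
invertible there, and cover the diagonal of `Q₀`. -/
structure IsGoodDomain (D : SmoothDiscretization E Q) (Q₀ : TopologicalSpace.Opens Q) (h : ℝ)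
    (V : TopologicalSpace.Opens (TangentBundle 𝓘(ℝ, E) Q)) : Prop where
  hasSmoothRightInverseAt : ∀ v ∈ V, D.HasSmoothRightInverseAt h v
  injOn : InjOn (D.bdPair h) V
  plus_mem : ∀ v ∈ V, D.bdPlus h v ∈ Q₀
  minus_mem : ∀ v ∈ V, D.bdMinus h v ∈ Q₀
  exists_diagonal : ∀ q ∈ Q₀, ∃ v ∈ V, D.bdPair h v = (q, q)

namespace IsGoodDomain

variable {D : SmoothDiscretization E Q} {Q₀ : TopologicalSpace.Opens Q} {h : ℝ}
  {V : TopologicalSpace.Opens (TangentBundle 𝓘(ℝ, E) Q)}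

/-- The restriction of `∂⁺_h` to a good domain. -/
def dp (H : D.IsGoodDomain Q₀ h V) (v : V) : Q₀ := ⟨D.bdPlus h v, H.plus_mem v v.2⟩

/-- The restriction of `∂⁻_h` to a good domain. -/
def dm (H : D.IsGoodDomain Q₀ h V) (v : V) : Q₀ := ⟨D.bdMinus h v, H.minus_mem v v.2⟩

/-- The restriction of `∂^±_h` to a good domain. -/
def pair (H : D.IsGoodDomain Q₀ h V) (v : V) : Q₀ × Q₀ := (H.dp v, H.dm v)

theorem contMDiff_dp (H : D.IsGoodDomain Q₀ h V) :
    ContMDiff 𝓘(ℝ, E).tangent 𝓘(ℝ, E) ∞ H.dp := by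
  rw [← ContMDiff.subtypeVal_comp_iff]
  exact fun v => contMDiffAt_subtype_iff.2
    (D.contMDiffAt_bdPlus (H.hasSmoothRightInverseAt v v.2).1)

theorem contMDiff_dm (H : D.IsGoodDomain Q₀ h V) :
    ContMDiff 𝓘(ℝ, E).tangent 𝓘(ℝ, E) ∞ H.dm := by
  rw [← ContMDiff.subtypeVal_comp_iff]
  exact fun v => contMDiffAt_subtype_iff.2
    (D.contMDiffAt_bdMinus (H.hasSmoothRightInverseAt v v.2).2.1)

theorem contMDiff_pair (H : D.IsGoodDomain Q₀ h V) :
    ContMDiff 𝓘(ℝ, E).tangent (𝓘(ℝ, E).prod 𝓘(ℝ, E)) ∞ H.pair :=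
  H.contMDiff_dp.prodMk H.contMDiff_dm

theorem bdPair_eq (H : D.IsGoodDomain Q₀ h V) (v : V) :
    D.bdPair h v = Prod.map Subtype.val Subtype.val (H.pair v) := rfl

theorem pair_injective (H : D.IsGoodDomain Q₀ h V) : Function.Injective H.pair := by
  intro v w hvw
  refine Subtype.ext (H.injOn v.2 w.2 ?_)
  rw [H.bdPair_eq, H.bdPair_eq, hvw]

theorem exists_local_inverse (H : D.IsGoodDomain Q₀ h V) (v : V) :
    ∃ g : Q₀ × Q₀ → TangentBundle 𝓘(ℝ, E) Q,
      ContMDiffAt (𝓘(ℝ, E).prod 𝓘(ℝ, E)) 𝓘(ℝ, E).tangent ∞ g (H.pair v) ∧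
      ∀ᶠ w in 𝓝 (H.pair v), ∃ u : V, u = g w ∧ H.pair u = w := by
  obtain ⟨-, -, g, hg, hgv, hgr⟩ := H.hasSmoothRightInverseAt v v.2
  have hι : ContMDiff (𝓘(ℝ, E).prod 𝓘(ℝ, E)) (𝓘(ℝ, E).prod 𝓘(ℝ, E)) ∞
      (Prod.map Subtype.val Subtype.val : Q₀ × Q₀ → Q × Q) :=
    contMDiff_subtype_val.prodMap contMDiff_subtype_val
  rw [H.bdPair_eq] at hg hgv hgr
  have hgι : ContMDiffAt (𝓘(ℝ, E).prod 𝓘(ℝ, E)) 𝓘(ℝ, E).tangent ∞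
      (g ∘ Prod.map Subtype.val Subtype.val : Q₀ × Q₀ → TangentBundle 𝓘(ℝ, E) Q) (H.pair v) :=
    hg.comp _ hι.contMDiffAt
  refine ⟨g ∘ Prod.map Subtype.val Subtype.val, hgι, ?_⟩
  have e1 : ∀ᶠ w in 𝓝 (H.pair v), g (Prod.map Subtype.val Subtype.val w) ∈ V :=
    hgι.continuousAt.eventually (V.isOpen.mem_nhds (by
      show g (Prod.map Subtype.val Subtype.val (H.pair v)) ∈ V
      rw [hgv]
      exact v.2))
  filter_upwards [e1, hι.continuous.continuousAt.eventually hgr] with w hw1 hw2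
  refine ⟨⟨_, hw1⟩, rfl, ?_⟩
  have := H.bdPair_eq ⟨_, hw1⟩
  rw [hw2] at this
  exact (Subtype.val_injective.prodMap Subtype.val_injective this).symm

theorem isOpen_range_pair (H : D.IsGoodDomain Q₀ h V) : IsOpen (range H.pair) := by
  rw [isOpen_iff_mem_nhds]
  rintro _ ⟨v, rfl⟩
  obtain ⟨g, -, hg⟩ := H.exists_local_inverse v
  exact hg.mono fun w ⟨u, _, hu⟩ => ⟨u, hu⟩

/-- By injectivity, the global inverse agrees near each image point with the smooth local right
inverse. -/
theorem contMDiffAt_invFun_pair (H : D.IsGoodDomain Q₀ h V) [Nonempty V] (v : V) :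
    ContMDiffAt (𝓘(ℝ, E).prod 𝓘(ℝ, E)) 𝓘(ℝ, E).tangent ∞ (Function.invFun H.pair)
      (H.pair v) := by
  rw [← ContMDiffAt.subtypeVal_comp_iff]
  obtain ⟨g, hg, hgr⟩ := H.exists_local_inverse v
  refine hg.congr_of_eventuallyEq (hgr.mono ?_)
  rintro w ⟨u, hu, rfl⟩
  rw [Function.comp_apply, Function.leftInverse_invFun H.pair_injective u, hu]

theorem isLocalDiffeomorph_pair (H : D.IsGoodDomain Q₀ h V) :
    IsLocalDiffeomorph 𝓘(ℝ, E).tangent (𝓘(ℝ, E).prod 𝓘(ℝ, E)) ∞ H.pair := by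
  intro v
  have : Nonempty V := ⟨v⟩
  refine ⟨{ toFun := H.pair
            invFun := Function.invFun H.pair
            source := univ
            target := range H.pair
            map_source' := fun u _ => mem_range_self u
            map_target' := fun _ _ => mem_univ _
            left_inv' := fun u _ => Function.leftInverse_invFun H.pair_injective u
            right_inv' := fun w hw => Function.invFun_eq hw
            open_source := isOpen_univ
            open_target := H.isOpen_range_pair
            contMDiffOn_toFun := H.contMDiff_pair.contMDiffOn
            contMDiffOn_invFun := ?_ }, mem_univ v, fun u _ => rfl⟩
  rintro _ ⟨u, rfl⟩
  exact (H.contMDiffAt_invFun_pair u).contMDiffWithinAt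

theorem mfderiv_pair (H : D.IsGoodDomain Q₀ h V) (v : V) (w : TangentSpace 𝓘(ℝ, E).tangent v) :
    mfderiv 𝓘(ℝ, E).tangent (𝓘(ℝ, E).prod 𝓘(ℝ, E)) H.pair v w =
      (mfderiv 𝓘(ℝ, E).tangent 𝓘(ℝ, E) H.dp v w, mfderiv 𝓘(ℝ, E).tangent 𝓘(ℝ, E) H.dm v w) := by
  have := (H.contMDiff_dp.mdifferentiableAt (x := v) (by simp)).mfderiv_prod
    (H.contMDiff_dm.mdifferentiableAt (x := v) (by simp))
  exact congrArg (fun L => L w) this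

theorem mfderiv_pair_bijective (H : D.IsGoodDomain Q₀ h V) (v : V) :
    Function.Bijective (mfderiv 𝓘(ℝ, E).tangent (𝓘(ℝ, E).prod 𝓘(ℝ, E)) H.pair v) :=
  ((H.isLocalDiffeomorph_pair v).mfderivToContinuousLinearEquiv (by simp)).bijective

/-- The derivative of the pair is bijective: hitting `(y, 0)` and `(0, y)` gives the two
submersions, and injectivity gives the kernel condition. -/
theorem isDiscreteTangentBundle [FiniteDimensional ℝ E] [T2Space Q] (H : D.IsGoodDomain Q₀ h V) :
    IsDiscreteTangentBundle 𝓘(ℝ, E).tangent 𝓘(ℝ, E) H.dp H.dm where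
  t2Space_total := by
    have : T2Space (TangentBundle 𝓘(ℝ, E) Q) := t2Space_tangentBundle
    infer_instance
  finrank_eq := by rw [Module.finrank_prod, two_mul]
  smooth_plus := H.contMDiff_dp
  smooth_minus := H.contMDiff_dm
  submersion_plus v y := by
    obtain ⟨w, hw⟩ := (H.mfderiv_pair_bijective v).2 (y, 0)
    rw [H.mfderiv_pair] at hw
    exact ⟨w, congrArg Prod.fst hw⟩
  submersion_minus v y := by
    obtain ⟨w, hw⟩ := (H.mfderiv_pair_bijective v).2 (0, y)
    rw [H.mfderiv_pair] at hw
    exact ⟨w, congrArg Prod.snd hw⟩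
  ker_inf_ker v w hp hm := by
    refine (H.mfderiv_pair_bijective v).1 ?_
    rw [map_zero, H.mfderiv_pair, hp, hm]
    rfl
  existsUnique_zero q := by
    obtain ⟨v, hv, hvq⟩ := H.exists_diagonal q q.2
    refine ⟨⟨v, hv⟩, ⟨Subtype.ext (congrArg Prod.fst hvq), Subtype.ext (congrArg Prod.snd hvq)⟩,
      fun u hu => H.pair_injective ?_⟩
    rw [pair, hu.1, hu.2]
    exact Prod.ext (Subtype.ext (congrArg Prod.fst hvq).symm)
      (Subtype.ext (congrArg Prod.snd hvq).symm)

/-- The image of a good domain under `∂^±_h`. -/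
def image (H : D.IsGoodDomain Q₀ h V) : TopologicalSpace.Opens (Q₀ × Q₀) :=
  ⟨range H.pair, H.isOpen_range_pair⟩

/-- The diffeomorphism from a good domain onto its image induced by `∂^±_h`. -/
noncomputable def diffeomorph (H : D.IsGoodDomain Q₀ h V) :
    Diffeomorph 𝓘(ℝ, E).tangent (𝓘(ℝ, E).prod 𝓘(ℝ, E)) V H.image ∞ where
  toEquiv := Equiv.ofInjective H.pair H.pair_injective
  contMDiff_toFun := by
    rw [← ContMDiff.subtypeVal_comp_iff]
    exact H.contMDiff_pair
  contMDiff_invFun := by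
    rintro ⟨_, v, rfl⟩
    have : Nonempty V := ⟨v⟩
    have h1 : ContMDiffAt (𝓘(ℝ, E).prod 𝓘(ℝ, E)) 𝓘(ℝ, E).tangent ∞
        (Function.invFun H.pair ∘ (Subtype.val : H.image → Q₀ × Q₀)) ⟨H.pair v, v, rfl⟩ :=
      (H.contMDiffAt_invFun_pair v).comp (⟨H.pair v, v, rfl⟩ : H.image)
        contMDiff_subtype_val.contMDiffAt
    refine h1.congr_of_eventuallyEq (Eventually.of_forall ?_)
    rintro ⟨_, u, rfl⟩
    rw [Function.comp_apply, Function.leftInverse_invFun H.pair_injective u]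
    exact Equiv.ofInjective_symm_apply H.pair_injective u

theorem diagonal_mem_image (H : D.IsGoodDomain Q₀ h V) (q : Q₀) : (q, q) ∈ H.image := by
  obtain ⟨v, hv, hvq⟩ := H.exists_diagonal q q.2
  exact ⟨⟨v, hv⟩, Prod.ext (Subtype.ext (congrArg Prod.fst hvq))
    (Subtype.ext (congrArg Prod.snd hvq))⟩

end IsGoodDomain

end SmoothDiscretization

/-! ### Compact exhaustion and uniformity in the step -/

namespace SmoothDiscretization

variable {E : Type*} [NormedAddCommGroup E] [NormedSpace ℝ E] [FiniteDimensional ℝ E]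
  {Q : Type*} [TopologicalSpace Q] [ChartedSpace E Q] [IsManifold 𝓘(ℝ, E) ∞ Q]

theorem exists_compact_exhaustion {C : Set Q} (hC : IsCompact C) :
    ∃ K : ℕ → Set (TangentBundle 𝓘(ℝ, E) Q), (∀ n, IsCompact (K n)) ∧ Monotone K ∧
      (∀ q ∈ C, (⟨q, 0⟩ : TangentBundle 𝓘(ℝ, E) Q) ∈ interior (K 0)) ∧
      ∀ v : TangentBundle 𝓘(ℝ, E) Q, v.proj ∈ C → ∃ n, v ∈ interior (K n) := by
  have hr : ∀ q : Q, ∃ r > 0, closedBall (extChartAt 𝓘(ℝ, E) q q) r ⊆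
      (extChartAt 𝓘(ℝ, E) q).target := fun q =>
    nhds_basis_closedBall.mem_iff.1
      ((isOpen_extChartAt_target q).mem_nhds (mem_extChartAt_target q))
  choose r hr0 hr using hr
  set B : Q → Set Q := fun q => (chartAt E q).source ∩
    extChartAt 𝓘(ℝ, E) q ⁻¹' ball (extChartAt 𝓘(ℝ, E) q q) (r q) with hB
  have hBn : ∀ q, B q ∈ 𝓝 q := fun q => inter_mem (chart_source_mem_nhds E q)
    ((continuousAt_extChartAt q).preimage_mem_nhds (ball_mem_nhds _ (hr0 q)))
  obtain ⟨t, -, ht⟩ := hC.elim_nhds_subcover B fun q _ => hBn q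
  -- Finitely many chart balls cover `C`; the fibre radius `n + 1` is positive at `n = 0`, so `K 0`
  -- is a neighbourhood of the zero vectors over `C`.
  set K : ℕ → Set (TangentBundle 𝓘(ℝ, E) Q) := fun n => ⋃ q ∈ t, (tangentChart q).symm ''
    (closedBall (extChartAt 𝓘(ℝ, E) q q) (r q) ×ˢ closedBall (0 : E) (n + 1)) with hK
  have hint : ∀ (v : TangentBundle 𝓘(ℝ, E) Q) (q : Q) (n : ℕ), q ∈ t → v.proj ∈ B q →
      ‖(tangentChart q v).2‖ < n + 1 → v ∈ interior (K n) := by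
    intro v q n hq hv hn
    have hsrc : v ∈ (tangentChart q).source := by
      rw [tangentChart_source]
      exact hv.1
    have hmem : (tangentChart q).source ∩ tangentChart q ⁻¹'
        (ball (extChartAt 𝓘(ℝ, E) q q) (r q) ×ˢ ball (0 : E) (n + 1)) ∈ 𝓝 v :=
      inter_mem ((isOpen_extChartAt_source _).mem_nhds hsrc)
        ((continuousAt_extChartAt' hsrc).preimage_mem_nhds
          ((isOpen_ball.prod isOpen_ball).mem_nhds ⟨hv.2, mem_ball_zero_iff.2 hn⟩))
    refine mem_interior_iff_mem_nhds.2 (mem_of_superset hmem ?_)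
    rintro u ⟨hu, hu'⟩
    exact mem_iUnion₂.2 ⟨q, hq, tangentChart q u,
      prod_mono ball_subset_closedBall ball_subset_closedBall hu', (tangentChart q).left_inv hu⟩
  refine ⟨K, fun n => ?_, fun m n hmn => ?_, fun q hq => ?_, fun v hv => ?_⟩
  · refine t.isCompact_biUnion fun q _ => ?_
    refine ((isCompact_closedBall _ _).prod (isCompact_closedBall _ _)).image_of_continuousOn ?_
    refine (continuousOn_extChartAt_symm (I := 𝓘(ℝ, E).tangent)
      (⟨q, 0⟩ : TangentBundle 𝓘(ℝ, E) Q)).mono ?_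
    change _ ⊆ (tangentChart (E := E) q).target
    rw [tangentChart_target]
    exact prod_mono (hr q) (subset_univ _)
  · refine iUnion₂_mono fun q _ => image_mono (prod_mono subset_rfl (closedBall_subset_closedBall ?_))
    gcongr
  · obtain ⟨x, hx, hqx⟩ := mem_iUnion₂.1 (ht hq)
    exact hint _ x 0 hx hqx (by rw [tangentChart_zero x q hqx.1]; simp)
  · obtain ⟨x, hx, hqx⟩ := mem_iUnion₂.1 (ht hv)
    obtain ⟨n, hn⟩ := exists_nat_gt ‖(tangentChart x v).2‖
    exact ⟨n, hint v x n hx hqx (by linarith)⟩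

theorem eventually_forall_mem_of_isCompact {X : Type*} [TopologicalSpace X] {l : Filter ℝ}
    {K : Set X} (hK : IsCompact K) {P : ℝ → X → Prop}
    (hP : ∀ x ∈ K, ∀ᶠ p : ℝ × X in l ×ˢ 𝓝 x, P p.1 p.2) : ∀ᶠ h in l, ∀ x ∈ K, P h x := by
  have h1 : ∀ᶠ p : ℝ × X in l ×ˢ 𝓝ˢ K, P p.1 p.2 := hK.mem_prod_nhdsSet_of_forall hP
  exact h1.curry.mono fun h hh x hx => hh.self_of_nhdsSet x hx

theorem eventually_good_of_isCompact [T2Space Q] (D : SmoothDiscretization E Q)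
    {K : Set (TangentBundle 𝓘(ℝ, E) Q)} (hK : IsCompact K) :
    ∀ᶠ h in 𝓝[>] (0 : ℝ), (∀ v ∈ K, D.HasSmoothRightInverseAt h v) ∧ InjOn (D.bdPair h) K := by
  refine (eventually_forall_mem_of_isCompact hK
    fun v _ => D.eventually_hasSmoothRightInverseAt v).and ?_
  have := eventually_forall_mem_of_isCompact (hK.prod hK)
    (P := fun h w => D.bdPair h w.1 = D.bdPair h w.2 → w.1 = w.2)
    fun w _ => D.eventually_injective w.1 w.2
  exact this.mono fun h hh v hv w hw => hh (v, w) ⟨hv, hw⟩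

end SmoothDiscretization

/-! ### Assembly of the domains -/

open SmoothDiscretization in
theorem mainTheorem7
    {E : Type*} [NormedAddCommGroup E] [NormedSpace ℝ E] [FiniteDimensional ℝ E]
    {Q : Type*} [TopologicalSpace Q] [T2Space Q] [ChartedSpace E Q] [IsManifold 𝓘(ℝ, E) ∞ Q]
    (D : SmoothDiscretization E Q)
    (Q₀ : TopologicalSpace.Opens Q) (hQ₀ : IsCompact (closure (Q₀ : Set Q))) :
    ∃ a : ℝ, 0 < a ∧ a ≤ D.a ∧
      ∃ V : ℝ → TopologicalSpace.Opens (TangentBundle 𝓘(ℝ, E) Q),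
        (∀ h ∈ Ioo 0 a,
          (∀ v ∈ V h, (h, v) ∈ D.domPlus ∧ (h, v) ∈ D.domMinus) ∧
          ∃ dp dm : V h → Q₀,
            (∀ v : V h, (dp v : Q) = D.bdPlus h v) ∧
            (∀ v : V h, (dm v : Q) = D.bdMinus h v) ∧
            IsDiscreteTangentBundle (𝓘(ℝ, E).tangent) 𝓘(ℝ, E) dp dm ∧
            ∃ W : TopologicalSpace.Opens (Q₀ × Q₀),
              (∀ q : Q₀, (q, q) ∈ W) ∧
              ∃ Φ : Diffeomorph (𝓘(ℝ, E).tangent) (𝓘(ℝ, E).prod 𝓘(ℝ, E)) (V h) W ∞,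
                ∀ v : V h, (Φ v : Q₀ × Q₀) = (dp v, dm v)) ∧
        (∀ v : TangentBundle 𝓘(ℝ, E) Q, v.proj ∈ Q₀ →
          ∃ a' : ℝ, 0 < a' ∧ a' ≤ a ∧ ∀ h ∈ Ioo 0 a', v ∈ V h) := by
  obtain ⟨K, hKc, hKm, hK0, hKe⟩ := exists_compact_exhaustion (E := E) hQ₀
  set P : ℕ → ℝ → Prop := fun n h =>
    (∀ v ∈ K n, D.HasSmoothRightInverseAt h v) ∧ InjOn (D.bdPair h) (K n) with hP
  have hPe : ∀ n, ∀ᶠ h in 𝓝[>] (0 : ℝ), P n h := fun n => D.eventually_good_of_isCompact (hKc n)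
  set s : ℕ → ℝ → Set (TangentBundle 𝓘(ℝ, E) Q) := fun n h =>
    {v ∈ interior (K n) | D.bdPlus h v ∈ Q₀ ∧ D.bdMinus h v ∈ Q₀} with hs
  have hso : ∀ n h, P n h → IsOpen (s n h) := fun n h hn =>
    D.isOpen_setOf_bdPair_mem isOpen_interior (fun v hv => hn.1 v (interior_subset hv)) Q₀
  -- The range of good steps may shrink with `n`, so `V h` takes the union over exactly those stages
  -- that are good for `h`; no choice of `n` depending on `h` is needed.
  let V : ℝ → TopologicalSpace.Opens (TangentBundle 𝓘(ℝ, E) Q) := fun h =>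
    ⟨⋃ n, ⋃ (_ : P n h), s n h, isOpen_iUnion fun n => isOpen_iUnion fun hn => hso n h hn⟩
  have hV : ∀ h v, v ∈ V h ↔ ∃ n, P n h ∧ v ∈ s n h := fun h v => by
    change v ∈ ⋃ n, ⋃ (_ : P n h), s n h ↔ _
    simp only [mem_iUnion, exists_prop]
  have hdiag : ∀ᶠ h in 𝓝[>] (0 : ℝ), ∀ q ∈ closure (Q₀ : Set Q),
      ∃ v ∈ interior (K 0), D.bdPair h v = (q, q) :=
    eventually_forall_mem_of_isCompact hQ₀ fun q hq =>
      D.eventually_exists_diagonal q (isOpen_interior.mem_nhds (hK0 q hq))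
  -- Stage `0` alone determines `a`: it already contains the preimages of the diagonal.
  obtain ⟨a₁, ha₁, hgood⟩ := mem_nhdsGT_iff_exists_Ioo_subset.1 ((hPe 0).and hdiag)
  have hpos : 0 < min a₁ D.a := lt_min ha₁ D.a_pos
  have H : ∀ h ∈ Ioo 0 (min a₁ D.a), D.IsGoodDomain Q₀ h (V h) := by
    intro h hh
    obtain ⟨hP0, hd⟩ := hgood ⟨hh.1, hh.2.trans_le (min_le_left _ _)⟩
    constructor
    · intro v hv
      obtain ⟨n, hn, hvn⟩ := (hV h v).1 hv
      exact hn.1 v (interior_subset hvn.1)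
    -- The sets `K n` increase, so both vectors lie in the larger of their two good stages, where
    -- injectivity holds.
    · intro v hv w hw hvw
      obtain ⟨n, hn, hvn⟩ := (hV h v).1 hv
      obtain ⟨m, hm, hwm⟩ := (hV h w).1 hw
      rcases le_total n m with hnm | hnm
      · exact hm.2 (hKm hnm (interior_subset hvn.1)) (interior_subset hwm.1) hvw
      · exact hn.2 (interior_subset hvn.1) (hKm hnm (interior_subset hwm.1)) hvw
    · intro v hv
      obtain ⟨n, -, hvn⟩ := (hV h v).1 hv
      exact hvn.2.1
    · intro v hv
      obtain ⟨n, -, hvn⟩ := (hV h v).1 hv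
      exact hvn.2.2
    · intro q hq
      obtain ⟨v, hv, hvq⟩ := hd q (subset_closure hq)
      refine ⟨v, (hV h v).2 ⟨0, hP0, hv, ?_, ?_⟩, hvq⟩
      · rw [show D.bdPlus h v = q from congrArg Prod.fst hvq]
        exact hq
      · rw [show D.bdMinus h v = q from congrArg Prod.snd hvq]
        exact hq
  refine ⟨min a₁ D.a, hpos, min_le_right _ _, V, fun h hh => ?_, fun v hv => ?_⟩
  · have Hh := H h hh
    exact ⟨fun v hv => ⟨(Hh.hasSmoothRightInverseAt v hv).1, (Hh.hasSmoothRightInverseAt v hv).2.1⟩,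
      Hh.dp, Hh.dm, fun _ => rfl, fun _ => rfl, Hh.isDiscreteTangentBundle, Hh.image,
      Hh.diagonal_mem_image, Hh.diffeomorph, fun _ => rfl⟩
  -- A fixed vector lies in the interior of some `K n`; this stage is good for small `h`, and both
  -- boundary values tend to the base point, hence enter `Q₀`.
  · obtain ⟨n, hn⟩ := hKe v (subset_closure hv)
    have h1 : Tendsto (fun h : ℝ => D.bdPair h v) (𝓝[>] 0) (𝓝 (v.proj, v.proj)) :=
      (D.tendsto_bdPair v).comp (tendsto_id.prodMk tendsto_const_nhds)
    have h2 := h1.eventually ((Q₀.isOpen.prod Q₀.isOpen).mem_nhds ⟨hv, hv⟩)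
    obtain ⟨a', ha', hsub⟩ := mem_nhdsGT_iff_exists_Ioo_subset.1 ((hPe n).and h2)
    refine ⟨min a' (min a₁ D.a), lt_min ha' hpos, min_le_right _ _, fun h hh => ?_⟩
    obtain ⟨hPn, hmem⟩ := hsub ⟨hh.1, hh.2.trans_le (min_le_left _ _)⟩
    exact (hV h v).2 ⟨n, hPn, hn, hmem.1, hmem.2⟩
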